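/- **Theorem (minimax duality with perturbation of the initial distribution).** *Setting.* Let $\Xi$ be a Polish space (e.g. a Polish subset of $\mathbb R^{d}$), $T\ge 1$ a number of periods, and $\mathcal U\subseteq\Xi^{T}$ a compact set of paths $U=(\xi_1,\dots,\xi_T)$. Let $F_0$ be a Borel probability measure on $\mathcal U$ (the reference law, e.g. the law of a Markov chain), and let $\nu_T$ be its terminal marginal, i.e. the law of $\xi_T$ under $F_0$. For $\nu\in\mathcal P(\Xi)$ let $\Pi(\nu,\nu_T)$ be the set of Borel probability measures $F$ on $\mathcal U$ under which $\xi_1$ has law $\nu$ and $\xi_T$ has law $\nu_T$ (the intermediate marginals are free). Let $\mathcal N\subseteq\mathcal P(\Xi)$ be convex and closed for weak convergence (e.g. a Kullback–Leibler ball $\{\nu: D_{KL}(\nu\|\nu_1)\le\delta_1\}$ around an initial distribution $\nu_1$), let $\delta\ge 0$, and put $$\mathcal F_{\mathcal N}=\{F\in\mathcal P(\mathcal U): F\in\Pi(\nu,\nu_T)\text{ for some }\nu\in\mathcal N,\ D_{KL}(F\|F_0)\le\delta\}.$$ Let $\Theta,\mathcal V$ be sets, and let $\mathcal G$ be a nonempty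 convex subset of a real vector space with $-g\in\mathcal G$ and $\eta g\in\mathcal G$ for all $g\in\mathcal G$, $\eta\ge 0$. Let $s(U;\theta,v)\in\mathbb R$, $m(U;\theta,v)\in\mathbb R^{d_P}$ and $\psi(U;\theta,v,g)\in\mathbb R$ be such that $\psi$ is linear in $g\in\mathcal G$ and such that, for all $(\theta,v,g)\in\Theta\times\mathcal V\times\mathcal G$, the functions $s$, $\psi$ and the components of $m$ are lower semicontinuous in $U\in\mathcal U$ and $|s|+\|m\|_1+|\psi|\le C_{\theta,v,g}$ on $\mathcal U$ for some finite constant $C_{\theta,v,g}$. For $P\in\mathbb R^{d_P}$ define the relaxed time-inhomogeneous lower bound $$\tilde\kappa_{\mathrm{TI,Initial}}(\delta,P)=\inf\Big\{\mathbb E_F[s(U;\theta,v)]:\ (\theta,v,F)\in\Theta\times\mathcal V\times\mathcal F_{\mathcal N},\ \mathbb E_F[m(U;\theta,v)]=P,\ \sup_{g\in\mathcal G}\mathbb E_F[\psi(U;\theta,v,g)]=0\Big\}\in[-\infty,\infty]$$ (with $\inf\emptyset=+\infty$), the cost $c(U;\theta,v,g,\lambda)=s(U;\theta,v)+\lambda^{\mathsf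 T}m(U;\theta,v)+\psi(U;\theta,v,g)$, and, for $\lambda\in\mathbb R^{d_P}$ and $\lambda_{KL}\ge0$, the Schrödinger bridge / entropic optimal transport problem with perturbed initial distribution $$\mathcal C_{\mathrm{TI,Initial}}(\theta,v,g,\lambda,\lambda_{KL})=\inf_{\nu\in\mathcal N}\ \inf_{F\in\Pi(\nu,\nu_T)}\ \mathbb E_F[c(U;\theta,v,g,\lambda)]+\lambda_{KL}\,D_{KL}(F\|F_0),\qquad 0\cdot\infty:=0 .$$ *Conclusion.* Then, as an equality in $[-\infty,\infty]$, $$\tilde\kappa_{\mathrm{TI,Initial}}(\delta,P)=\inf_{(\theta,v)\in\Theta\times\mathcal V}\ \ \sup_{\lambda\in\mathbb R^{d_P},\ \lambda_{KL}\ge 0,\ g\in\mathcal G}\ \ \mathcal C_{\mathrm{TI,Initial}}(\theta,v,g,\lambda,\lambda_{KL})-\lambda_{KL}\,\delta-\lambda^{\mathsf T}P .$$ -/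

import Mathlib

open MeasureTheory InformationTheory
open scoped NNReal ENNReal

noncomputable section

namespace PathDuality

variable {Ξ : Type*} [MeasurableSpace Ξ]

/-- The initial marginal (law of the first coordinate) of a law `F` on a path space
`𝒰 ⊆ Ξ ^ (n + 1)`. -/
def initialLaw {n : ℕ} {𝒰 : Set (Fin (n + 1) → Ξ)} (F : ProbabilityMeasure 𝒰) : Measure Ξ :=
  (F : Measure 𝒰).map (fun U : 𝒰 => U.1 0)

/-- The terminal marginal (law of the last coordinate). -/
def terminalLaw {n : ℕ} {𝒰 : Set (Fin (n + 1) → Ξ)} (F : ProbabilityMeasure 𝒰) : Measure Ξ :=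
  (F : Measure 𝒰).map (fun U : 𝒰 => U.1 (Fin.last n))

/-- `Π(ν, μ)`: the laws on the path space with initial marginal `ν` and terminal marginal `μ`;
the intermediate marginals are free. -/
def couplings {n : ℕ} (𝒰 : Set (Fin (n + 1) → Ξ)) (ν μ : Measure Ξ) :
    Set (ProbabilityMeasure 𝒰) :=
  {F | initialLaw F = ν ∧ terminalLaw F = μ}

/-- The relaxed perturbation set: laws `F ∈ Π(ν, ν_T)` for some `ν ∈ N`, with
`D_KL(F ‖ F₀) ≤ δ`, where `ν_T` is the terminal marginal of `F₀`. -/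
def perturbationSet {n : ℕ} {𝒰 : Set (Fin (n + 1) → Ξ)} (F₀ : ProbabilityMeasure 𝒰)
    (N : Set (ProbabilityMeasure Ξ)) (δ : ℝ≥0) : Set (ProbabilityMeasure 𝒰) :=
  {F | (∃ ν ∈ N, F ∈ couplings 𝒰 (ν : Measure Ξ) (terminalLaw F₀)) ∧
    klDiv (F : Measure 𝒰) (F₀ : Measure 𝒰) ≤ δ}

/-- The lower bound on the scalar parameter: the infimum of `E_F[s]` over `(θ, v)` and over `F` in
the relaxed perturbation set, subject to `E_F[m] = P` and `sup_{g ∈ G} E_F[ψ(·, g)] = 0`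
(with value `+∞` if the problem is infeasible). -/
def lowerBound {n dP : ℕ} {𝒰 : Set (Fin (n + 1) → Ξ)} {Θ V 𝓛 : Type*}
    (F₀ : ProbabilityMeasure 𝒰) (N : Set (ProbabilityMeasure Ξ)) (G : Set 𝓛)
    (s : 𝒰 → Θ → V → ℝ) (m : 𝒰 → Θ → V → Fin dP → ℝ) (ψ : 𝒰 → Θ → V → 𝓛 → ℝ)
    (δ : ℝ≥0) (P : Fin dP → ℝ) : EReal :=
  ⨅ (θ : Θ) (v : V) (F : ProbabilityMeasure 𝒰) (_ : F ∈ perturbationSet F₀ N δ)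
    (_ : ∀ i, ∫ U, m U θ v i ∂(F : Measure 𝒰) = P i)
    (_ : (⨆ g ∈ G, ((∫ U, ψ U θ v g ∂(F : Measure 𝒰) : ℝ) : EReal)) = 0),
    ((∫ U, s U θ v ∂(F : Measure 𝒰) : ℝ) : EReal)

/-- The cost `c(U; θ, v, g, λ) = s + λᵀ m + ψ`. -/
def cost {n dP : ℕ} {𝒰 : Set (Fin (n + 1) → Ξ)} {Θ V 𝓛 : Type*}
    (s : 𝒰 → Θ → V → ℝ) (m : 𝒰 → Θ → V → Fin dP → ℝ) (ψ : 𝒰 → Θ → V → 𝓛 → ℝ)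
    (θ : Θ) (v : V) (g : 𝓛) (lam : Fin dP → ℝ) (U : 𝒰) : ℝ :=
  s U θ v + ∑ i, lam i * m U θ v i + ψ U θ v g

/-- The inner problem: the infimum over `ν ∈ N` of the Schrödinger bridge values
`inf_{F ∈ Π(ν, ν_T)} E_F[c] + λ_KL D_KL(F ‖ F₀)`, where `0 * ∞ = 0`. -/
def bridgeValue {n dP : ℕ} {𝒰 : Set (Fin (n + 1) → Ξ)} {Θ V 𝓛 : Type*}
    (F₀ : ProbabilityMeasure 𝒰) (N : Set (ProbabilityMeasure Ξ))
    (s : 𝒰 → Θ → V → ℝ) (m : 𝒰 → Θ → V → Fin dP → ℝ) (ψ : 𝒰 → Θ → V → 𝓛 → ℝ)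
    (θ : Θ) (v : V) (g : 𝓛) (lam : Fin dP → ℝ) (lamKL : ℝ≥0) : EReal :=
  ⨅ ν ∈ N, ⨅ F ∈ couplings 𝒰 (ν : Measure Ξ) (terminalLaw F₀),
    ((∫ U, cost s m ψ θ v g lam U ∂(F : Measure 𝒰) : ℝ) : EReal) +
      (((lamKL : ℝ≥0∞) * klDiv (F : Measure 𝒰) (F₀ : Measure 𝒰) : ℝ≥0∞) : EReal)

end PathDuality

end

/-! Both sides are infima over `(θ, v)`, so it suffices to prove Lagrangian duality with `(θ, v)`
fixed. Weak duality evaluates the bridge problem at a feasible law. There `E[ψ] ≤ 0` and the entropy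
is at most `δ`, so each dual value is at most `E[s]`.

For the converse, take a real `a` strictly above the dual value. Each multiplier `(λ, g, t)` with `t
> 0` has a law whose Lagrangian lies below `a`, and the task is to find one law that serves all
multipliers. For finitely many of them this is Hahn–Banach in finite dimension together with
concavity of the Lagrangian in the multiplier (`exists_weights_nonneg_of_convexOn`).

Passing to all multipliers is a compactness argument with no compact set. Laws of finite entropy are
identified with densities in `L¹(F₀)`, where relative entropy is uniformly midpoint convex, by a
Pinsker-type bound (`entropy_midpoint_add_le`). Near-minimisers of the entropy over a decreasing
family of convex sets therefore form a Cauchy net (`exists_tendsto_of_uniformly_midpoint_convex`).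
Its limit stays in every sublevel set, since linear terms are `L¹`-continuous and entropy is lower
semicontinuous by Fatou.

The Lagrangian of the limit law is thus bounded by `a` for all multipliers. Large `t` forces the
entropy constraint, `t → 0` removes the entropy term, and unbounded `λ` and multiples of `g` force
the moment equalities. -/

open Filter Topology

/-! ### Minimax by separation and convex compactness -/

/-- A finite family of convex functions whose maximum is nonnegative on a convex set has a convex
combination that is nonnegative there. -/
theorem exists_weights_nonneg_of_convexOn {X ι : Type*} [AddCommGroup X] [Module ℝ X] [Fintype ι]
    {D : Set X} (hD : Convex ℝ D) (hne : D.Nonempty) {ℓ : ι → X → ℝ}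
    (hℓ : ∀ i, ConvexOn ℝ D (ℓ i)) (h : ∀ x ∈ D, ∃ i, 0 ≤ ℓ i x) :
    ∃ w : ι → ℝ, (∀ i, 0 ≤ w i) ∧ ∑ i, w i = 1 ∧ ∀ x ∈ D, 0 ≤ ∑ i, w i * ℓ i x := by
  classical
  -- The strict upper image of `D` is open, convex and misses the origin. A functional separating it
  -- from `0` supplies the weights.
  let A : Set (ι → ℝ) := {z | ∃ x ∈ D, ∀ i, ℓ i x < z i}
  have hAconv : Convex ℝ A := by
    rintro z ⟨x, hx, hxz⟩ z' ⟨x', hx', hxz'⟩ a b ha hb hab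
    refine ⟨a • x + b • x', hD hx hx' ha hb hab, fun i => ?_⟩
    refine ((hℓ i).2 hx hx' ha hb hab).trans_lt ?_
    simp only [Pi.add_apply, Pi.smul_apply, smul_eq_mul]
    rcases ha.eq_or_lt with rfl | ha'
    · obtain rfl : b = 1 := by linarith
      simpa using hxz' i
    · have h1 := mul_lt_mul_of_pos_left (hxz i) ha'
      have h2 := mul_le_mul_of_nonneg_left (hxz' i).le hb
      linarith
  have hAopen : IsOpen A := by
    have : A = ⋃ x ∈ D, Set.pi Set.univ (fun i => Set.Ioi (ℓ i x)) := by
      ext z; simp [A, Set.mem_pi]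
    rw [this]
    exact isOpen_biUnion fun x _ => isOpen_set_pi Set.finite_univ fun i _ => isOpen_Ioi
  have h0 : (0 : ι → ℝ) ∉ A := by
    rintro ⟨x, hx, hx0⟩
    obtain ⟨i, hi⟩ := h x hx
    exact absurd (hx0 i) (not_lt.mpr hi)
  obtain ⟨φ, hφ⟩ := geometric_hahn_banach_point_open hAconv hAopen h0
  rw [map_zero] at hφ
  let u : ι → ℝ := fun i => φ (Pi.single i 1)
  have hφu : ∀ z : ι → ℝ, φ z = ∑ i, u i * z i := by
    intro z
    conv_lhs => rw [pi_eq_sum_univ' z]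
    rw [map_sum]
    refine Finset.sum_congr rfl fun i _ => ?_
    rw [map_smul, smul_eq_mul, mul_comm]
  have hlim : ∀ x ∈ D, ∀ ε : ℝ, 0 < ε → 0 < ∑ i, u i * (ℓ i x + ε) := by
    intro x hx ε hε
    rw [← hφu]
    exact hφ _ ⟨x, hx, fun i => by simpa using hε⟩
  obtain ⟨x₀, hx₀⟩ := hne
  have hu : ∀ i, 0 ≤ u i := by
    intro j
    by_contra hj
    push Not at hj
    let S := ∑ i, u i * (ℓ i x₀ + 1)
    have hS : 0 < S := hlim x₀ hx₀ 1 one_pos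
    -- `A` is closed under raising coordinates. If `u j < 0`, raising coordinate `j` by `S / (-u j)`
    -- brings the functional from `S` down to exactly `0`.
    have h1 : 0 < φ (fun i => ℓ i x₀ + 1 + if i = j then S / (-u j) else 0) := by
      refine hφ _ ⟨x₀, hx₀, fun i => ?_⟩
      have : 0 ≤ (if i = j then S / (-u j) else 0) := by
        split_ifs
        · exact div_nonneg hS.le (by linarith)
        · exact le_rfl
      linarith
    rw [hφu] at h1
    simp only [mul_add _ (_ + _), Finset.sum_add_distrib, mul_ite, mul_zero,
      Finset.sum_ite_eq', Finset.mem_univ, if_true] at h1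
    have h2 : u j * (S / -u j) = -S := by
      have := hj.ne
      field_simp
    rw [h2] at h1
    simp [S] at h1
  have hU : 0 < ∑ i, u i := by
    refine lt_of_le_of_ne (Finset.sum_nonneg fun i _ => hu i) fun h0 => ?_
    have hz := (Finset.sum_eq_zero_iff_of_nonneg fun i _ => hu i).1 h0.symm
    have := hlim x₀ hx₀ 1 one_pos
    rw [Finset.sum_eq_zero fun i hi => by rw [hz i hi, zero_mul]] at this
    exact lt_irrefl _ this
  refine ⟨fun i => u i / ∑ j, u j, fun i => div_nonneg (hu i) hU.le, ?_, fun x hx => ?_⟩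
  · rw [← Finset.sum_div, div_self hU.ne']
  · have h1 : 0 ≤ ∑ i, u i * ℓ i x := by
      refine le_of_forall_pos_le_add fun ε hε => ?_
      have := hlim x hx (ε / ∑ i, u i) (div_pos hε hU)
      simp only [mul_add, Finset.sum_add_distrib, ← Finset.sum_mul] at this
      rw [mul_div_cancel₀ _ hU.ne'] at this
      exact this.le
    have : ∑ i, u i / (∑ j, u j) * ℓ i x = (∑ i, u i * ℓ i x) / ∑ j, u j := by
      rw [Finset.sum_div]
      exact Finset.sum_congr rfl fun i _ => by ring
    rw [this]
    exact div_nonneg h1 hU.le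

/-- Convex compactness: in a complete space, a downward directed family of nonempty convex sets on
which a uniformly midpoint convex function has bounded infimum contains a convergent net of
selections. -/
theorem exists_tendsto_of_uniformly_midpoint_convex {X I : Type*} [NormedAddCommGroup X]
    [NormedSpace ℝ X] [CompleteSpace X] [SemilatticeSup I] [Nonempty I] {C : I → Set X}
    (hanti : Antitone C) (hconv : ∀ i, Convex ℝ (C i)) (hne : ∀ i, (C i).Nonempty)
    {H : X → ℝ} {c R : ℝ} (hc : 0 < c)
    (hH0 : ∀ i, ∀ x ∈ C i, 0 ≤ H x) (hHR : ∀ i, ∃ x ∈ C i, H x ≤ R)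
    (hH : ∀ i, ∀ x ∈ C i, ∀ y ∈ C i,
      H ((1 / 2 : ℝ) • x + (1 / 2 : ℝ) • y) + c * ‖x - y‖ ^ 2 ≤ (H x + H y) / 2) :
    ∃ (u : I × ℕ → X) (x : X), (∀ p, u p ∈ C p.1) ∧ Tendsto u atTop (𝓝 x) := by
  -- The infima `r i` increase along the family and are bounded by `R`, so near-minimisers over
  -- far-out sets have almost equal values of `H`.
  let r : I → ℝ := fun i => sInf (H '' C i)
  have hbdd : ∀ i, BddBelow (H '' C i) := fun i => ⟨0, by rintro _ ⟨x, hx, rfl⟩; exact hH0 i x hx⟩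
  have hrle : ∀ i, ∀ x ∈ C i, r i ≤ H x := fun i x hx => csInf_le (hbdd i) ⟨x, hx, rfl⟩
  have hrR : BddAbove (Set.range r) := ⟨R, by
    rintro _ ⟨i, rfl⟩
    obtain ⟨x, hx, hxR⟩ := hHR i
    exact (hrle i x hx).trans hxR⟩
  have hex : ∀ p : I × ℕ, ∃ x ∈ C p.1, H x < r p.1 + 1 / ((p.2 : ℝ) + 1) := by
    intro p
    have hlt : r p.1 < r p.1 + 1 / ((p.2 : ℝ) + 1) := by
      have : 0 < 1 / ((p.2 : ℝ) + 1) := by positivity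
      linarith
    obtain ⟨_, ⟨x, hx, rfl⟩, hxlt⟩ := exists_lt_of_csInf_lt ((hne p.1).image H) hlt
    exact ⟨x, hx, hxlt⟩
  choose u huC huH using hex
  have hcauchy : CauchySeq u := by
    rw [Metric.cauchySeq_iff']
    intro ε hε
    have hη : 0 < c * ε ^ 2 / 2 := by positivity
    obtain ⟨i₀, hi₀⟩ := exists_lt_of_lt_ciSup (sub_lt_self (⨆ i, r i) hη)
    obtain ⟨n₀, hn₀⟩ := exists_nat_one_div_lt hη
    refine ⟨(i₀, n₀), fun p hp => ?_⟩
    have hbound : ∀ q : I × ℕ, (i₀, n₀) ≤ q → u q ∈ C i₀ ∧ H (u q) < (⨆ i, r i) + c * ε ^ 2 / 2 := by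
      intro q hq
      refine ⟨hanti hq.1 (huC q), ?_⟩
      have h1 := huH q
      have h2 : r q.1 ≤ ⨆ i, r i := le_ciSup hrR q.1
      have h3 : 1 / ((q.2 : ℝ) + 1) ≤ 1 / ((n₀ : ℝ) + 1) := by
        have : (n₀ : ℝ) ≤ q.2 := by exact_mod_cast hq.2
        exact one_div_le_one_div_of_le (by positivity) (by linarith)
      linarith
    obtain ⟨hp1, hp2⟩ := hbound p hp
    obtain ⟨hq1, hq2⟩ := hbound _ le_rfl
    -- The midpoint stays in `C i₀`, so its value is at least `r i₀ > sup r - c ε² / 2`. Both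
    -- endpoints lie below `sup r + c ε² / 2`, which leaves less than `c ε²` for the convexity gap.
    have hmid := hrle i₀ _ (hconv i₀ hp1 hq1 (a := 1 / 2) (b := 1 / 2) (by norm_num) (by norm_num)
      (by norm_num))
    have h4 := hH i₀ _ hp1 _ hq1
    rw [dist_eq_norm]
    have h5 : c * ‖u p - u (i₀, n₀)‖ ^ 2 < c * ε ^ 2 := by linarith
    exact lt_of_pow_lt_pow_left₀ 2 hε.le (lt_of_mul_lt_mul_left h5 hc.le)
  obtain ⟨x, hx⟩ := cauchySeq_tendsto_of_complete hcauchy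
  exact ⟨u, x, huC, hx⟩

/-- A minimax theorem without compactness: a convex-concave function with closed sublevel sets, one
of which lies in a sublevel set of a uniformly midpoint convex function. -/
theorem exists_forall_le_of_forall_exists_lt {X Y : Type*} [NormedAddCommGroup X]
    [NormedSpace ℝ X] [CompleteSpace X] [AddCommGroup Y] [Module ℝ Y]
    {D : Set X} (hD : Convex ℝ D) {Q : Set Y} {L : X → Y → ℝ} {a : ℝ}
    (hconv : ∀ y ∈ Q, ConvexOn ℝ D fun x => L x y) (hconc : ∀ x ∈ D, ConcaveOn ℝ Q (L x))
    (hclosed : ∀ y ∈ Q, IsClosed {x ∈ D | L x y ≤ a})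
    {H : X → ℝ} {c R : ℝ} (hc : 0 < c) (hH0 : ∀ x ∈ D, 0 ≤ H x)
    (hH : ∀ x ∈ D, ∀ y ∈ D,
      H ((1 / 2 : ℝ) • x + (1 / 2 : ℝ) • y) + c * ‖x - y‖ ^ 2 ≤ (H x + H y) / 2)
    {y₀ : Y} (hy₀ : y₀ ∈ Q) (hR : ∀ x ∈ D, L x y₀ ≤ a → H x ≤ R)
    (hlt : ∀ y ∈ Q, ∃ x ∈ D, L x y < a) :
    ∃ x ∈ D, ∀ y ∈ Q, L x y ≤ a := by
  classical
  have hfin : ∀ t : Finset Q, ∃ x ∈ D, ∀ y ∈ t, L x (y : Y) < a := by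
    intro t
    by_contra hcon
    push Not at hcon
    obtain ⟨x₁, hx₁, -⟩ := hlt y₀ hy₀
    obtain ⟨w, hw0, hw1, hw⟩ := exists_weights_nonneg_of_convexOn (ι := t) hD ⟨x₁, hx₁⟩
      (ℓ := fun y x => L x ((y : Q) : Y) - a)
      (fun y => (hconv _ (y : Q).2).sub (concaveOn_const a hD))
      (fun x hx => by
        obtain ⟨y, hy, hya⟩ := hcon x hx
        exact ⟨⟨y, hy⟩, by simpa using hya⟩)
    -- By concavity the averaged multiplier satisfies `L x ≥ a` on all of `D`, contradicting `hlt`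
    -- at that single multiplier.
    obtain ⟨x, hx, hxa⟩ := hlt (∑ y, w y • ((y : Q) : Y))
      ((hconc x₁ hx₁).1.sum_mem (fun y _ => hw0 y) hw1 fun y _ => (y : Q).2)
    have h1 := (hconc x hx).le_map_sum (t := Finset.univ) (w := w) (p := fun y : t => ((y : Q) : Y))
      (fun y _ => hw0 y) hw1 fun y _ => (y : Q).2
    have h2 := hw x hx
    simp only [mul_sub, Finset.sum_sub_distrib, ← Finset.sum_mul, hw1, one_mul] at h2
    simp only [smul_eq_mul] at h1
    linarith
  -- The constraint at `y₀` is built into every set, because that is where `H` is bounded by `R`.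
  let C : Finset Q → Set X := fun t => {x ∈ D | L x y₀ ≤ a ∧ ∀ y ∈ t, L x (y : Y) ≤ a}
  have hCne : ∀ t, (C t).Nonempty := by
    intro t
    obtain ⟨x, hx, hxt⟩ := hfin (insert ⟨y₀, hy₀⟩ t)
    exact ⟨x, hx, (hxt _ (Finset.mem_insert_self _ _)).le,
      fun y hy => (hxt y (Finset.mem_insert_of_mem hy)).le⟩
  obtain ⟨u, x, hu, hux⟩ := exists_tendsto_of_uniformly_midpoint_convex (C := C) (H := H) (R := R)
    (fun t t' htt' x hx => ⟨hx.1, hx.2.1, fun y hy => hx.2.2 y (Finset.mem_of_subset htt' hy)⟩)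
    (fun t x hx y hy p q hp hq hpq => by
      have key : ∀ z ∈ Q, L x z ≤ a → L y z ≤ a → L (p • x + q • y) z ≤ a := fun z hz h1 h2 =>
        ((hconv z hz).convex_le a ⟨hx.1, h1⟩ ⟨hy.1, h2⟩ hp hq hpq).2
      exact ⟨hD hx.1 hy.1 hp hq hpq, key _ hy₀ hx.2.1 hy.2.1,
        fun z hz => key z z.2 (hx.2.2 z hz) (hy.2.2 z hz)⟩)
    hCne hc (fun t x hx => hH0 x hx.1)
    (fun t => (hCne t).imp fun x hx => ⟨hx, hR x hx.1 hx.2.1⟩)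
    (fun t x hx y hy => hH x hx.1 y hy.1)
  have hmem : ∀ y : Q, x ∈ {x ∈ D | L x (y : Y) ≤ a} := by
    intro y
    refine (hclosed y y.2).mem_of_tendsto hux ?_
    filter_upwards [eventually_ge_atTop (({y} : Finset Q), 0)] with p hp
    exact ⟨(hu p).1, (hu p).2.2 y (hp.1 (Finset.mem_singleton_self y))⟩
  exact ⟨x, (hmem ⟨y₀, hy₀⟩).1, fun y hy => (hmem ⟨y, hy⟩).2⟩

/-! ### Uniform convexity of the entropy integrand -/

namespace InformationTheory

/-- Strong midpoint convexity of `klFun`, in a form that integrates to a Pinsker-type bound. -/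
theorem klFun_midpoint_add_le {a b : ℝ} (ha : 0 ≤ a) (hb : 0 ≤ b) (τ : ℝ) :
    klFun ((a + b) / 2) + (2 * τ * |a - b| - τ ^ 2 * (a + b)) / 8 ≤ (klFun a + klFun b) / 2 := by
  -- With square roots as variables, `log z ≤ z - 1` bounds the convexity gap below by `(√a - √b)² /
  -- 4`. The quadratic in `τ` then follows by completing squares.
  obtain ⟨p, hp, rfl⟩ : ∃ p : ℝ, 0 ≤ p ∧ a = p ^ 2 :=
    ⟨√a, Real.sqrt_nonneg a, (Real.sq_sqrt ha).symm⟩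
  obtain ⟨q, hq, rfl⟩ : ∃ q : ℝ, 0 ≤ q ∧ b = q ^ 2 :=
    ⟨√b, Real.sqrt_nonneg b, (Real.sq_sqrt hb).symm⟩
  obtain ⟨r, hr, hrm⟩ : ∃ r : ℝ, 0 ≤ r ∧ (p ^ 2 + q ^ 2) / 2 = r ^ 2 :=
    ⟨√((p ^ 2 + q ^ 2) / 2), Real.sqrt_nonneg _, (Real.sq_sqrt (by positivity)).symm⟩
  rw [hrm]
  have key : ∀ x : ℝ, 0 ≤ x → (x = 0 ∨ 0 < r) →
      2 * x ^ 2 - 2 * x * r ≤ x ^ 2 * Real.log (x ^ 2) - x ^ 2 * Real.log (r ^ 2) := by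
    intro x hx hxr
    rcases hx.eq_or_lt with rfl | hx'
    · simp
    have hr' : 0 < r := hxr.resolve_left hx'.ne'
    have h1 := Real.log_le_sub_one_of_pos (div_pos hr' hx')
    rw [Real.log_div hr'.ne' hx'.ne'] at h1
    rw [Real.log_pow, Real.log_pow]
    have h2 := mul_le_mul_of_nonneg_left h1 (by positivity : (0 : ℝ) ≤ 2 * x ^ 2)
    have h3 : 2 * x ^ 2 * (r / x - 1) = 2 * x * r - 2 * x ^ 2 := by field_simp
    rw [h3] at h2
    push_cast
    linarith
  have hpos : ∀ x : ℝ, x ^ 2 ≤ 2 * r ^ 2 → (x = 0 ∨ 0 < r) := by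
    intro x hx
    rcases hr.eq_or_lt with h | h
    · left; rw [← h] at hx; nlinarith
    · exact Or.inr h
  have h1 := key p hp (hpos p (by nlinarith))
  have h2 := key q hq (hpos q (by nlinarith))
  have h3 : |p ^ 2 - q ^ 2| = |p - q| * (p + q) := by
    rw [sq_sub_sq, mul_comm, abs_mul, abs_of_nonneg (add_nonneg hp hq)]
  have h4 : |p - q| ^ 2 = (p - q) ^ 2 := sq_abs _
  rw [klFun_apply, klFun_apply, klFun_apply, h3]
  have h5 : 0 ≤ (2 * |p - q| - τ * (p + q)) ^ 2 := sq_nonneg _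
  have h6 : 0 ≤ τ ^ 2 * (p - q) ^ 2 := by positivity
  have h7 : 0 ≤ (2 * r - (p + q)) ^ 2 := sq_nonneg _
  have h8 : (p ^ 2 + q ^ 2) * Real.log (r ^ 2) = 2 * (r ^ 2 * Real.log (r ^ 2)) := by
    rw [← mul_assoc, ← hrm]; ring
  nlinarith

end InformationTheory

/-! ### Densities in `L¹` and bounded integrands -/

namespace MeasureTheory

variable {α : Type*} [MeasurableSpace α] {μ : Measure α}

theorem integrable_L1_mul_of_bounded (f : Lp ℝ 1 μ) {h : α → ℝ} (hm : Measurable h)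
    {C : ℝ} (hC : ∀ x, |h x| ≤ C) : Integrable (fun x => f x * h x) μ :=
  (L1.integrable_coeFn f).mul_bdd (c := C) hm.aestronglyMeasurable (ae_of_all _ hC)

/-- The bound on `h` is a Lipschitz constant. Strong `L¹` convergence of densities thus needs only
measurability of a bounded integrand. -/
theorem continuous_integral_L1_mul {h : α → ℝ} (hm : Measurable h) {C : ℝ}
    (hC : ∀ x, |h x| ≤ C) : Continuous fun f : Lp ℝ 1 μ => ∫ x, f x * h x ∂μ := by
  refine LipschitzWith.continuous (K := C.toNNReal) (LipschitzWith.of_dist_le_mul fun f g => ?_)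
  rw [Real.dist_eq, ← integral_sub (integrable_L1_mul_of_bounded f hm hC)
    (integrable_L1_mul_of_bounded g hm hC), dist_eq_norm, L1.norm_eq_integral_norm,
    ← integral_const_mul]
  refine abs_integral_le_integral_abs.trans ?_
  refine integral_mono_ae ?_ ?_ ?_
  · exact ((integrable_L1_mul_of_bounded f hm hC).sub (integrable_L1_mul_of_bounded g hm hC)).abs
  · exact (L1.integrable_coeFn (f - g)).norm.const_mul _
  · filter_upwards [Lp.coeFn_sub f g] with x hx
    rw [hx, Pi.sub_apply, ← sub_mul, abs_mul, mul_comm, Real.norm_eq_abs]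
    exact mul_le_mul_of_nonneg_right ((hC x).trans (Real.le_coe_toNNReal C)) (abs_nonneg _)

theorem integral_L1_combo_mul {h : α → ℝ} (hm : Measurable h) {C : ℝ} (hC : ∀ x, |h x| ≤ C)
    (f g : Lp ℝ 1 μ) (a b : ℝ) :
    ∫ x, (a • f + b • g : Lp ℝ 1 μ) x * h x ∂μ =
      a * ∫ x, f x * h x ∂μ + b * ∫ x, g x * h x ∂μ := by
  rw [← integral_const_mul, ← integral_const_mul, ← integral_add
    ((integrable_L1_mul_of_bounded f hm hC).const_mul a)
    ((integrable_L1_mul_of_bounded g hm hC).const_mul b)]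
  refine integral_congr_ae ?_
  filter_upwards [Lp.coeFn_add (a • f) (b • g), Lp.coeFn_smul a f, Lp.coeFn_smul b g] with x h1 h2 h3
  rw [h1, Pi.add_apply, h2, h3]
  simp only [Pi.smul_apply, smul_eq_mul]
  ring

/-- The measure with a given integrable density. -/
noncomputable def densityMeasure (f : Lp ℝ 1 μ) : Measure α :=
  μ.withDensity fun x => ENNReal.ofReal (f x)

theorem Lp.aemeasurable_ofReal (f : Lp ℝ 1 μ) : AEMeasurable (fun x => ENNReal.ofReal (f x)) μ :=
  (Lp.aestronglyMeasurable f).aemeasurable.ennreal_ofReal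

theorem integral_densityMeasure {f : Lp ℝ 1 μ} (hf : 0 ≤ᵐ[μ] f) (h : α → ℝ) :
    ∫ x, h x ∂densityMeasure f = ∫ x, f x * h x ∂μ := by
  rw [densityMeasure, integral_withDensity_eq_integral_toReal_smul₀ (Lp.aemeasurable_ofReal f)
    (ae_of_all _ fun x => ENNReal.ofReal_lt_top)]
  refine integral_congr_ae ?_
  filter_upwards [hf] with x hx
  rw [ENNReal.toReal_ofReal hx, smul_eq_mul]

theorem densityMeasure_univ {f : Lp ℝ 1 μ} (hf : 0 ≤ᵐ[μ] f) :
    densityMeasure f Set.univ = ENNReal.ofReal (∫ x, f x ∂μ) := by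
  rw [densityMeasure, withDensity_apply _ MeasurableSet.univ, Measure.restrict_univ,
    ofReal_integral_eq_lintegral_ofReal (L1.integrable_coeFn f) hf]

theorem Lp.nonneg_combo {f g : Lp ℝ 1 μ} (hf : 0 ≤ᵐ[μ] f) (hg : 0 ≤ᵐ[μ] g) {a b : ℝ}
    (ha : 0 ≤ a) (hb : 0 ≤ b) : 0 ≤ᵐ[μ] (a • f + b • g : Lp ℝ 1 μ) := by
  filter_upwards [Lp.coeFn_add (a • f) (b • g), Lp.coeFn_smul a f, Lp.coeFn_smul b g, hf, hg]
    with x h1 h2 h3 h4 h5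
  rw [h1, Pi.add_apply, h2, h3]
  exact add_nonneg (mul_nonneg ha h4) (mul_nonneg hb h5)

theorem densityMeasure_combo {f g : Lp ℝ 1 μ} (hf : 0 ≤ᵐ[μ] f) (hg : 0 ≤ᵐ[μ] g) {a b : ℝ≥0} :
    densityMeasure ((a : ℝ) • f + (b : ℝ) • g : Lp ℝ 1 μ) =
      a • densityMeasure f + b • densityMeasure g := by
  have hsmul : ∀ (c : ℝ≥0) (k : Lp ℝ 1 μ) (s : Set α), MeasurableSet s →
      c • densityMeasure k s = ∫⁻ x in s, c * ENNReal.ofReal (k x) ∂μ := fun c k s hs => by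
    rw [lintegral_const_mul' _ _ ENNReal.coe_ne_top, densityMeasure, withDensity_apply _ hs]
    rfl
  ext s hs
  rw [Measure.add_apply, Measure.smul_apply, Measure.smul_apply, hsmul _ _ _ hs, hsmul _ _ _ hs,
    ← lintegral_add_left' ((Lp.aemeasurable_ofReal f).const_mul _).restrict, densityMeasure,
    withDensity_apply _ hs]
  refine lintegral_congr_ae (ae_restrict_of_ae ?_)
  filter_upwards [Lp.coeFn_add ((a : ℝ) • f) ((b : ℝ) • g), Lp.coeFn_smul (a : ℝ) f,
    Lp.coeFn_smul (b : ℝ) g, hf, hg] with x h1 h2 h3 h4 h5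
  rw [h1, Pi.add_apply, h2, h3]
  simp only [Pi.smul_apply, smul_eq_mul]
  rw [ENNReal.ofReal_add (mul_nonneg a.coe_nonneg h4) (mul_nonneg b.coe_nonneg h5),
    ENNReal.ofReal_mul a.coe_nonneg, ENNReal.ofReal_mul b.coe_nonneg, ENNReal.ofReal_coe_nnreal,
    ENNReal.ofReal_coe_nnreal]

/-! ### Relative entropy on the set of densities -/

/-- The integrable densities of finite entropy of the laws in `K`. -/
def densitySet (μ : Measure α) (K : Set (ProbabilityMeasure α)) : Set (Lp ℝ 1 μ) :=
  {f | 0 ≤ᵐ[μ] f ∧ Integrable (fun x => klFun (f x)) μ ∧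
    ∃ F ∈ K, (F : Measure α) = densityMeasure f}

/-- The relative entropy as a function of the density. -/
noncomputable def entropy (f : Lp ℝ 1 μ) : ℝ := ∫ x, klFun (f x) ∂μ

theorem entropy_nonneg {f : Lp ℝ 1 μ} (hf : 0 ≤ᵐ[μ] f) : 0 ≤ entropy f :=
  integral_nonneg_of_ae (by filter_upwards [hf] with x hx using klFun_nonneg hx)

theorem integral_eq_one_of_densityMeasure {f : Lp ℝ 1 μ} (hf : 0 ≤ᵐ[μ] f)
    {F : ProbabilityMeasure α} (hF : (F : Measure α) = densityMeasure f) : ∫ x, f x ∂μ = 1 := by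
  have h := integral_densityMeasure hf fun _ => 1
  rw [← hF] at h
  simpa using h.symm

theorem klDiv_densityMeasure [IsProbabilityMeasure μ] {f : Lp ℝ 1 μ} (hf : 0 ≤ᵐ[μ] f)
    (hfi : Integrable (fun x => klFun (f x)) μ)
    {F : ProbabilityMeasure α} (hF : (F : Measure α) = densityMeasure f) :
    klDiv (F : Measure α) μ = ENNReal.ofReal (entropy f) := by
  have hac : (F : Measure α) ≪ μ := hF ▸ withDensity_absolutelyContinuous _ _
  rw [klDiv_eq_lintegral_klFun_of_ac hac, entropy, ofReal_integral_eq_lintegral_ofReal hfi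
    (by filter_upwards [hf] with x hx using klFun_nonneg hx)]
  refine lintegral_congr_ae ?_
  have hrn := Measure.rnDeriv_withDensity₀ μ (Lp.aemeasurable_ofReal f)
  rw [hF]
  filter_upwards [hrn, hf] with x h1 h2
  rw [densityMeasure, h1, ENNReal.toReal_ofReal h2]

/-- Radon–Nikodym: the passage from laws of finite entropy to points of `L¹`. -/
theorem exists_mem_densitySet [IsProbabilityMeasure μ] {K : Set (ProbabilityMeasure α)}
    {F : ProbabilityMeasure α} (hFK : F ∈ K) (hF : klDiv (F : Measure α) μ ≠ ∞) :
    ∃ f ∈ densitySet μ K, (F : Measure α) = densityMeasure f := by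
  obtain ⟨hac, hint⟩ := klDiv_ne_top_iff.1 hF
  have hi : Integrable (fun x => ((F : Measure α).rnDeriv μ x).toReal) μ :=
    Measure.integrable_toReal_rnDeriv
  let f : Lp ℝ 1 μ := hi.toL1 _
  have hf : f =ᵐ[μ] fun x => ((F : Measure α).rnDeriv μ x).toReal := hi.coeFn_toL1
  have hFf : (F : Measure α) = densityMeasure f := by
    conv_lhs => rw [← Measure.withDensity_rnDeriv_eq _ _ hac]
    refine withDensity_congr_ae ?_
    filter_upwards [hf, Measure.rnDeriv_lt_top (F : Measure α) μ] with x h1 h2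
    rw [h1, ENNReal.ofReal_toReal h2.ne]
  refine ⟨f, ⟨?_, ?_, F, hFK, hFf⟩, hFf⟩
  · filter_upwards [hf] with x hx
    rw [hx]
    exact ENNReal.toReal_nonneg
  · refine ((integrable_klFun_rnDeriv_iff hac).2 hint).congr ?_
    filter_upwards [hf] with x hx
    rw [hx]

theorem klFun_combo_ae {f g : Lp ℝ 1 μ} (hf : 0 ≤ᵐ[μ] f) (hg : 0 ≤ᵐ[μ] g) {a b : ℝ}
    (ha : 0 ≤ a) (hb : 0 ≤ b) (hab : a + b = 1) :
    ∀ᵐ x ∂μ, klFun ((a • f + b • g : Lp ℝ 1 μ) x) ≤ a * klFun (f x) + b * klFun (g x) := by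
  filter_upwards [Lp.coeFn_add (a • f) (b • g), Lp.coeFn_smul a f, Lp.coeFn_smul b g, hf, hg]
    with x h1 h2 h3 h4 h5
  rw [h1, Pi.add_apply, h2, h3]
  exact convexOn_klFun.2 h4 h5 ha hb hab

theorem integrable_klFun_combo {f g : Lp ℝ 1 μ} (hf : 0 ≤ᵐ[μ] f) (hg : 0 ≤ᵐ[μ] g)
    (hfi : Integrable (fun x => klFun (f x)) μ) (hgi : Integrable (fun x => klFun (g x)) μ)
    {a b : ℝ} (ha : 0 ≤ a) (hb : 0 ≤ b) (hab : a + b = 1) :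
    Integrable (fun x => klFun ((a • f + b • g : Lp ℝ 1 μ) x)) μ := by
  refine ((hfi.const_mul a).add (hgi.const_mul b)).mono'
    (continuous_klFun.comp_aestronglyMeasurable (Lp.aestronglyMeasurable _)) ?_
  filter_upwards [klFun_combo_ae hf hg ha hb hab, Lp.nonneg_combo hf hg ha hb] with x h1 h2
  rw [Real.norm_of_nonneg (klFun_nonneg h2)]
  exact h1

theorem convex_densitySet {K : Set (ProbabilityMeasure α)}
    (hK : ∀ F ∈ K, ∀ F' ∈ K, ∀ a b : ℝ≥0, a + b = 1 → ∃ E ∈ K,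
      (E : Measure α) = a • (F : Measure α) + b • (F' : Measure α)) :
    Convex ℝ (densitySet μ K) := by
  rintro f ⟨hf, hfi, F, hFK, hF⟩ g ⟨hg, hgi, F', hFK', hF'⟩ a b ha hb hab
  lift a to ℝ≥0 using ha
  lift b to ℝ≥0 using hb
  refine ⟨Lp.nonneg_combo hf hg a.2 b.2, integrable_klFun_combo hf hg hfi hgi a.2 b.2 hab, ?_⟩
  obtain ⟨E, hE, hEe⟩ := hK F hFK F' hFK' a b (by exact_mod_cast hab)
  exact ⟨E, hE, by rw [hEe, densityMeasure_combo hf hg, hF, hF']⟩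

theorem convexOn_entropy {K : Set (ProbabilityMeasure α)} (hK : Convex ℝ (densitySet μ K)) :
    ConvexOn ℝ (densitySet μ K) (entropy (μ := μ)) := by
  refine ⟨hK, fun f hf g hg a b ha hb hab => ?_⟩
  rw [entropy, entropy, entropy, smul_eq_mul, smul_eq_mul, ← integral_const_mul,
    ← integral_const_mul, ← integral_add (hf.2.1.const_mul a) (hg.2.1.const_mul b)]
  exact integral_mono_ae (integrable_klFun_combo hf.1 hg.1 hf.2.1 hg.2.1 ha hb hab)
    ((hf.2.1.const_mul a).add (hg.2.1.const_mul b)) (klFun_combo_ae hf.1 hg.1 ha hb hab)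

/-- Integrate `klFun_midpoint_add_le`. Since both densities have mass one, its correction becomes
`(2τd - 2τ²) / 8`, which is largest at `τ = d / 2` and equals `d² / 16` there. -/
theorem entropy_midpoint_add_le {K : Set (ProbabilityMeasure α)} {f g : Lp ℝ 1 μ}
    (hf : f ∈ densitySet μ K) (hg : g ∈ densitySet μ K) :
    entropy ((1 / 2 : ℝ) • f + (1 / 2 : ℝ) • g) + 1 / 16 * ‖f - g‖ ^ 2 ≤
      (entropy f + entropy g) / 2 := by
  obtain ⟨hf0, hfi, F, -, hF⟩ := hf
  obtain ⟨hg0, hgi, F', -, hF'⟩ := hg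
  set d := ‖f - g‖ with hd
  have hfI := L1.integrable_coeFn f
  have hgI := L1.integrable_coeFn g
  have hdi : Integrable (fun x => |f x - g x|) μ := (hfI.sub hgI).abs
  have hsum : Integrable (fun x => f x + g x) μ := hfI.add hgI
  have hd' : d = ∫ x, |f x - g x| ∂μ := by
    rw [hd, L1.norm_eq_integral_norm]
    refine integral_congr_ae ?_
    filter_upwards [Lp.coeFn_sub f g] with x hx
    rw [hx, Pi.sub_apply, Real.norm_eq_abs]
  have hmid := integrable_klFun_combo hf0 hg0 hfi hgi (a := 1 / 2) (b := 1 / 2) (by norm_num)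
    (by norm_num) (by norm_num)
  have hrest : Integrable (fun x => (2 * (d / 2) * |f x - g x| - (d / 2) ^ 2 * (f x + g x)) / 8) μ :=
    ((hdi.const_mul _).sub (hsum.const_mul _)).div_const 8
  have hle : ∫ x, (klFun (((1 / 2 : ℝ) • f + (1 / 2 : ℝ) • g : Lp ℝ 1 μ) x) +
      (2 * (d / 2) * |f x - g x| - (d / 2) ^ 2 * (f x + g x)) / 8) ∂μ ≤
      ∫ x, (klFun (f x) + klFun (g x)) / 2 ∂μ := by
    refine integral_mono_ae (hmid.add hrest) ((hfi.add hgi).div_const 2) ?_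
    filter_upwards [Lp.coeFn_add ((1 / 2 : ℝ) • f) ((1 / 2 : ℝ) • g),
      Lp.coeFn_smul (1 / 2 : ℝ) f, Lp.coeFn_smul (1 / 2 : ℝ) g, hf0, hg0] with x h1 h2 h3 h4 h5
    have h6 : ((1 / 2 : ℝ) • f + (1 / 2 : ℝ) • g : Lp ℝ 1 μ) x = (f x + g x) / 2 := by
      rw [h1, Pi.add_apply, h2, h3]
      simp only [Pi.smul_apply, smul_eq_mul]
      ring
    rw [h6]
    exact klFun_midpoint_add_le h4 h5 _
  have hval : ∫ x, (2 * (d / 2) * |f x - g x| - (d / 2) ^ 2 * (f x + g x)) / 8 ∂μ =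
      1 / 16 * d ^ 2 := by
    rw [integral_div, integral_sub (hdi.const_mul _) (hsum.const_mul _),
      integral_const_mul, integral_const_mul, integral_add hfI hgI,
      integral_eq_one_of_densityMeasure hf0 hF, integral_eq_one_of_densityMeasure hg0 hF', ← hd']
    ring
  rw [integral_add hmid hrest, hval, integral_div, integral_add hfi hgi] at hle
  exact hle

/-- Densities of finite entropy are closed under `L¹` limits with bounded entropy, and the entropy
is lower semicontinuous. -/
theorem mem_densitySet_of_tendsto [IsProbabilityMeasure μ] {K : Set (ProbabilityMeasure α)}
    (hK : ∀ (F : ℕ → ProbabilityMeasure α) (E : ProbabilityMeasure α), (∀ k, F k ∈ K) →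
      (∀ h : α → ℝ, Measurable h → (∃ C, ∀ x, |h x| ≤ C) →
        Tendsto (fun k => ∫ x, h x ∂(F k : Measure α)) atTop (𝓝 (∫ x, h x ∂(E : Measure α)))) →
      E ∈ K)
    {u : ℕ → Lp ℝ 1 μ} {f : Lp ℝ 1 μ} (hu : ∀ k, u k ∈ densitySet μ K)
    (huf : Tendsto u atTop (𝓝 f)) {b : ℕ → ℝ} {B : ℝ} (hb : ∀ k, entropy (u k) ≤ b k)
    (hbB : Tendsto b atTop (𝓝 B)) :
    f ∈ densitySet μ K ∧ entropy f ≤ B := by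
  choose hu0 hui F hFK hF using hu
  have hJ : ∀ h : α → ℝ, Measurable h → (∃ C, ∀ x, |h x| ≤ C) →
      Tendsto (fun k => ∫ x, u k x * h x ∂μ) atTop (𝓝 (∫ x, f x * h x ∂μ)) := by
    rintro h hm ⟨C, hC⟩
    exact ((continuous_integral_L1_mul hm hC).tendsto f).comp huf
  -- An a.e. convergent subsequence gives nonnegativity of the limit and allows Fatou for the
  -- nonnegative integrand `klFun`.
  obtain ⟨φ, hφ, hae⟩ := (tendstoInMeasure_of_tendsto_Lp huf).exists_seq_tendsto_ae
  have hae0 : ∀ᵐ x ∂μ, ∀ k, 0 ≤ u k x := ae_all_iff.2 hu0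
  have hf0 : 0 ≤ᵐ[μ] f := by
    filter_upwards [hae, hae0] with x h1 h2
    exact ge_of_tendsto' h1 fun k => h2 _
  have hmass : ∫ x, f x ∂μ = 1 := by
    have h1 := hJ (fun _ => 1) measurable_const ⟨1, fun _ => by simp⟩
    simp only [mul_one] at h1
    refine tendsto_nhds_unique h1 ?_
    simp only [fun k => integral_eq_one_of_densityMeasure (hu0 k) (hF k)]
    exact tendsto_const_nhds
  have hprob : IsProbabilityMeasure (densityMeasure f) :=
    ⟨by rw [densityMeasure_univ hf0, hmass, ENNReal.ofReal_one]⟩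
  have hfatou : ∫⁻ x, ENNReal.ofReal (klFun (f x)) ∂μ ≤ ENNReal.ofReal B := by
    calc ∫⁻ x, ENNReal.ofReal (klFun (f x)) ∂μ
        = ∫⁻ x, liminf (fun k => ENNReal.ofReal (klFun (u (φ k) x))) atTop ∂μ := by
          refine lintegral_congr_ae ?_
          filter_upwards [hae] with x hx
          exact (ENNReal.tendsto_ofReal ((continuous_klFun.tendsto _).comp hx)).liminf_eq.symm
      _ ≤ liminf (fun k => ∫⁻ x, ENNReal.ofReal (klFun (u (φ k) x)) ∂μ) atTop :=
          lintegral_liminf_le' fun k => (continuous_klFun.comp_aestronglyMeasurable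
            (Lp.aestronglyMeasurable _)).aemeasurable.ennreal_ofReal
      _ ≤ liminf (fun k => ENNReal.ofReal (b (φ k))) atTop := by
          refine liminf_le_liminf (Eventually.of_forall fun k => ?_)
          rw [← ofReal_integral_eq_lintegral_ofReal (hui _)
            (by filter_upwards [hu0 (φ k)] with x hx using klFun_nonneg hx)]
          exact ENNReal.ofReal_le_ofReal (hb _)
      _ = ENNReal.ofReal B :=
          (ENNReal.tendsto_ofReal (hbB.comp hφ.tendsto_atTop)).liminf_eq
  have hkl0 : 0 ≤ᵐ[μ] fun x => klFun (f x) := by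
    filter_upwards [hf0] with x hx using klFun_nonneg hx
  have hfi : Integrable (fun x => klFun (f x)) μ :=
    (lintegral_ofReal_ne_top_iff_integrable
      (continuous_klFun.comp_aestronglyMeasurable (Lp.aestronglyMeasurable _)) hkl0).1
      (hfatou.trans_lt ENNReal.ofReal_lt_top).ne
  have hB : 0 ≤ B := ge_of_tendsto' hbB fun k => (entropy_nonneg (hu0 k)).trans (hb k)
  refine ⟨⟨hf0, hfi, ⟨densityMeasure f, hprob⟩, hK F _ hFK fun h hm hC => ?_, rfl⟩, ?_⟩
  · change Tendsto _ _ (𝓝 (∫ x, h x ∂densityMeasure f))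
    rw [integral_densityMeasure hf0]
    simp only [hF, fun k => integral_densityMeasure (hu0 k) h]
    exact hJ h hm hC
  · rw [← ofReal_integral_eq_lintegral_ofReal hfi hkl0] at hfatou
    exact (ENNReal.ofReal_le_ofReal_iff hB).1 hfatou

end MeasureTheory

/-! ### Lagrangian duality under an entropy constraint -/

namespace MeasureTheory

/-- Lagrangian duality under a relative entropy constraint: if all values of the Lagrangian with
positive entropy multiplier have infimum below `a`, then some feasible law attains `a`. -/
theorem exists_klDiv_le_of_lagrangian_lt {α Y : Type*} [MeasurableSpace α] {μ : Measure α}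
    [IsProbabilityMeasure μ] [AddCommGroup Y] [Module ℝ Y] {K : Set (ProbabilityMeasure α)}
    (hKconv : ∀ F ∈ K, ∀ F' ∈ K, ∀ a b : ℝ≥0, a + b = 1 → ∃ E ∈ K,
      (E : Measure α) = a • (F : Measure α) + b • (F' : Measure α))
    (hKclosed : ∀ (F : ℕ → ProbabilityMeasure α) (E : ProbabilityMeasure α), (∀ k, F k ∈ K) →
      (∀ h : α → ℝ, Measurable h → (∃ C, ∀ x, |h x| ≤ C) →
        Tendsto (fun k => ∫ x, h x ∂(F k : Measure α)) atTop (𝓝 (∫ x, h x ∂(E : Measure α)))) →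
      E ∈ K)
    {Q : Set Y} (hQ : Convex ℝ Q) (hQne : Q.Nonempty) {c : Y → α → ℝ}
    (hcm : ∀ y ∈ Q, Measurable (c y)) (hcb : ∀ y ∈ Q, ∃ C, ∀ x, |c y x| ≤ C)
    (hclin : ∀ y ∈ Q, ∀ z ∈ Q, ∀ a b : ℝ, 0 ≤ a → 0 ≤ b → a + b = 1 → ∀ x,
      c (a • y + b • z) x = a * c y x + b * c z x)
    {δ a : ℝ}
    (hlt : ∀ y ∈ Q, ∀ t : ℝ, 0 < t → ∃ F ∈ K, klDiv (F : Measure α) μ ≠ ∞ ∧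
      ∫ x, c y x ∂(F : Measure α) + t * ((klDiv (F : Measure α) μ).toReal - δ) < a) :
    ∃ F ∈ K, klDiv (F : Measure α) μ ≤ ENNReal.ofReal δ ∧
      ∀ y ∈ Q, ∫ x, c y x ∂(F : Measure α) ≤ a := by
  let J : Y → Lp ℝ 1 μ → ℝ := fun y f => ∫ x, f x * c y x ∂μ
  have hD := convex_densitySet (μ := μ) hKconv
  have hHconv := convexOn_entropy (μ := μ) hD
  have hJcont : ∀ y ∈ Q, Continuous (J y) := fun y hy => by
    obtain ⟨C, hC⟩ := hcb y hy
    exact continuous_integral_L1_mul (hcm y hy) hC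
  have hval : ∀ f ∈ densitySet μ K, ∀ F : ProbabilityMeasure α,
      (F : Measure α) = densityMeasure f →
      (klDiv (F : Measure α) μ = ENNReal.ofReal (entropy f)) ∧
        ∀ y, ∫ x, c y x ∂(F : Measure α) = J y f := fun f hf F hF =>
    ⟨klDiv_densityMeasure hf.1 hf.2.1 hF, fun y => by rw [hF, integral_densityMeasure hf.1]⟩
  obtain ⟨y₀, hy₀⟩ := hQne
  obtain ⟨C₀, hC₀⟩ := hcb y₀ hy₀
  -- Entropy multipliers are kept strictly positive, so that every sublevel set bounds the entropy
  -- and is closed. At `(y₀, 1)` the linear term is at least `-C₀`, whence the bound `a + δ + C₀`.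
  obtain ⟨f, hf, hfle⟩ := exists_forall_le_of_forall_exists_lt (D := densitySet μ K) hD
    (Q := Q ×ˢ Set.Ioi (0 : ℝ)) (L := fun f p => J p.1 f + p.2 * (entropy f - δ)) (a := a)
    (H := entropy) (c := 1 / 16) (R := a + δ + C₀) (y₀ := (y₀, 1))
    (by
      rintro ⟨y, t⟩ ⟨hy, ht⟩
      refine ⟨hD, fun f hf g hg p q hp hq hpq => ?_⟩
      obtain ⟨C, hC⟩ := hcb y hy
      have h1 : J y (p • f + q • g) = p * J y f + q * J y g :=
        integral_L1_combo_mul (hcm y hy) hC f g p q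
      have h2 := mul_le_mul_of_nonneg_left (hHconv.2 hf hg hp hq hpq) (le_of_lt ht)
      simp only [smul_eq_mul] at h2 ⊢
      rw [h1]
      obtain rfl : q = 1 - p := by linarith
      linarith)
    (by
      intro f hf
      refine ⟨hQ.prod (convex_Ioi 0), ?_⟩
      rintro ⟨y, t⟩ ⟨hy, ht⟩ ⟨z, r⟩ ⟨hz, hr⟩ p q hp hq hpq
      obtain ⟨C, hC⟩ := hcb y hy
      obtain ⟨C', hC'⟩ := hcb z hz
      have h1 : J (p • y + q • z) f = p * J y f + q * J z f := by
        simp only [J]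
        rw [← integral_const_mul, ← integral_const_mul, ← integral_add
          ((integrable_L1_mul_of_bounded f (hcm y hy) hC).const_mul p)
          ((integrable_L1_mul_of_bounded f (hcm z hz) hC').const_mul q)]
        refine integral_congr_ae (ae_of_all _ fun x => ?_)
        simp only [hclin y hy z hz p q hp hq hpq x]
        ring
      simp only [smul_eq_mul, Prod.smul_mk, Prod.mk_add_mk, h1]
      apply le_of_eq
      ring)
    (by
      rintro ⟨y, t⟩ ⟨hy, ht⟩
      have ht' : (0 : ℝ) < t := ht
      refine isClosed_of_closure_subset fun f hf => ?_
      obtain ⟨u, hu, huf⟩ := mem_closure_iff_seq_limit.1 hf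
      -- Dividing by `t > 0` turns the sublevel condition into an entropy bound whose right side
      -- converges along the sequence.
      have hb : Tendsto (fun k => δ + (a - J y (u k)) / t) atTop (𝓝 (δ + (a - J y f) / t)) :=
        (((((hJcont y hy).tendsto f).comp huf).const_sub a).div_const t).const_add δ
      obtain ⟨h1, h2⟩ := mem_densitySet_of_tendsto hKclosed (fun k => (hu k).1) huf (fun k => by
        have h3 : J y (u k) + t * (entropy (u k) - δ) ≤ a := (hu k).2
        rw [← sub_le_iff_le_add', le_div_iff₀ ht']
        linarith) hb
      refine ⟨h1, ?_⟩
      rw [← sub_le_iff_le_add', le_div_iff₀ ht'] at h2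
      change J y f + t * (entropy f - δ) ≤ a
      linarith)
    (by norm_num) (fun f hf => entropy_nonneg hf.1)
    (fun f hf g hg => entropy_midpoint_add_le hf hg)
    ⟨hy₀, Set.mem_Ioi.2 one_pos⟩
    (by
      intro f hf hfa
      obtain ⟨F, hFK, hF⟩ := hf.2.2
      have h1 : |∫ x, c y₀ x ∂(F : Measure α)| ≤ C₀ := by
        simpa using norm_integral_le_of_norm_le_const (μ := (F : Measure α)) (f := c y₀)
          (ae_of_all _ hC₀)
      rw [(hval f hf F hF).2] at h1
      have := (abs_le.1 h1).1
      simp only at hfa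
      linarith)
    (by
      rintro ⟨y, t⟩ ⟨hy, ht⟩
      obtain ⟨F, hFK, hFkl, hFa⟩ := hlt y hy t ht
      obtain ⟨f, hf, hF⟩ := exists_mem_densitySet hFK hFkl
      refine ⟨f, hf, ?_⟩
      obtain ⟨h1, h2⟩ := hval f hf F hF
      rwa [h1, h2, ENNReal.toReal_ofReal (entropy_nonneg hf.1)] at hFa)
  obtain ⟨F, hFK, hF⟩ := hf.2.2
  obtain ⟨h1, h2⟩ := hval f hf F hF
  have hL : ∀ y ∈ Q, ∀ t : ℝ, 0 < t → J y f + t * (entropy f - δ) ≤ a := fun y hy t ht =>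
    hfle (y, t) ⟨hy, ht⟩
  have hent : entropy f ≤ δ := by
    by_contra hcon
    push Not at hcon
    have hpos : 0 < entropy f - δ := sub_pos.2 hcon
    -- This multiplier makes the penalty equal to `|a - J y₀ f| + 1`, which overshoots `a`.
    have h3 := hL y₀ hy₀ ((|a - J y₀ f| + 1) / (entropy f - δ)) (by positivity)
    rw [div_mul_cancel₀ _ hpos.ne'] at h3
    have := le_abs_self (a - J y₀ f)
    linarith
  refine ⟨F, hFK, h1 ▸ ENNReal.ofReal_le_ofReal hent, fun y hy => ?_⟩
  rw [h2]
  have hlim : Tendsto (fun t : ℝ => J y f + t * (entropy f - δ)) (𝓝[>] 0)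
      (𝓝 (J y f + 0 * (entropy f - δ))) :=
    ((continuous_id.mul continuous_const).const_add _).tendsto' _ _ rfl |>.mono_left
      nhdsWithin_le_nhds
  rw [zero_mul, add_zero] at hlim
  exact le_of_tendsto hlim (by filter_upwards [self_mem_nhdsWithin] with t ht using hL y hy t ht)

end MeasureTheory

/-! ### Stability of the marginal constraints -/

namespace PathDuality

/-- The laws on the path space with initial law in `N` and the terminal law of `F₀`. -/
def admissibleLaws {Ξ : Type*} [MeasurableSpace Ξ] {n : ℕ} {𝒰 : Set (Fin (n + 1) → Ξ)}
    (F₀ : ProbabilityMeasure 𝒰) (N : Set (ProbabilityMeasure Ξ)) : Set (ProbabilityMeasure 𝒰) :=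
  {F | ∃ ν ∈ N, F ∈ couplings 𝒰 (ν : Measure Ξ) (terminalLaw F₀)}

theorem measurable_coordinate {Ξ : Type*} [MeasurableSpace Ξ] {n : ℕ}
    {𝒰 : Set (Fin (n + 1) → Ξ)} (i : Fin (n + 1)) : Measurable fun U : 𝒰 => U.1 i :=
  (measurable_pi_apply i).comp measurable_subtype_coe

theorem admissibleLaws_combo {Ξ : Type*} [MeasurableSpace Ξ] {n : ℕ}
    {𝒰 : Set (Fin (n + 1) → Ξ)} (F₀ : ProbabilityMeasure 𝒰) {N : Set (ProbabilityMeasure Ξ)}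
    (hN : Convex ℝ≥0 ((fun ν : ProbabilityMeasure Ξ => (ν : Measure Ξ)) '' N)) :
    ∀ F ∈ admissibleLaws F₀ N, ∀ F' ∈ admissibleLaws F₀ N, ∀ a b : ℝ≥0, a + b = 1 →
      ∃ E ∈ admissibleLaws F₀ N,
        (E : Measure 𝒰) = a • (F : Measure 𝒰) + b • (F' : Measure 𝒰) := by
  rintro F ⟨ν, hν, hF1, hF2⟩ F' ⟨ν', hν', hF1', hF2'⟩ a b hab
  have hprob : IsProbabilityMeasure (a • (F : Measure 𝒰) + b • (F' : Measure 𝒰)) := by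
    constructor
    rw [Measure.add_apply, Measure.smul_apply, Measure.smul_apply, measure_univ, measure_univ,
      ← add_smul, hab, one_smul]
  have hmap : ∀ i, (a • (F : Measure 𝒰) + b • (F' : Measure 𝒰)).map (fun U : 𝒰 => U.1 i) =
      a • (F : Measure 𝒰).map (fun U : 𝒰 => U.1 i) +
        b • (F' : Measure 𝒰).map (fun U : 𝒰 => U.1 i) := fun i => by
    rw [Measure.map_add _ _ (measurable_coordinate i), Measure.map_smul, Measure.map_smul]
  obtain ⟨ν'', hν'', hνe⟩ := hN ⟨ν, hν, rfl⟩ ⟨ν', hν', rfl⟩ (zero_le (a := a)) (zero_le (a := b)) hab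
  refine ⟨⟨_, hprob⟩, ⟨ν'', hν'', ?_, ?_⟩, rfl⟩
  · refine (hmap 0).trans ?_
    change a • initialLaw F + b • initialLaw F' = _
    rw [hF1, hF1']
    exact hνe.symm
  · refine (hmap (Fin.last n)).trans ?_
    change a • terminalLaw F + b • terminalLaw F' = _
    rw [hF2, hF2', ← add_smul, hab, one_smul]

/-- Bounded continuous test functions of the first coordinate give weak convergence of the initial
laws, so closedness of `N` applies. Indicators in the last coordinate keep the terminal law fixed.
-/
theorem mem_admissibleLaws_of_tendsto {Ξ : Type*} [TopologicalSpace Ξ] [PolishSpace Ξ]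
    [MeasurableSpace Ξ] [BorelSpace Ξ] {n : ℕ} {𝒰 : Set (Fin (n + 1) → Ξ)}
    (F₀ : ProbabilityMeasure 𝒰) {N : Set (ProbabilityMeasure Ξ)} (hN : IsClosed N)
    (F : ℕ → ProbabilityMeasure 𝒰) (E : ProbabilityMeasure 𝒰)
    (hF : ∀ k, F k ∈ admissibleLaws F₀ N)
    (hlim : ∀ h : 𝒰 → ℝ, Measurable h → (∃ C, ∀ x, |h x| ≤ C) →
      Tendsto (fun k => ∫ x, h x ∂(F k : Measure 𝒰)) atTop (𝓝 (∫ x, h x ∂(E : Measure 𝒰)))) :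
    E ∈ admissibleLaws F₀ N := by
  choose ν hνN hF1 hF2 using hF
  have hm0 := measurable_coordinate (𝒰 := 𝒰) 0
  have hml := measurable_coordinate (𝒰 := 𝒰) (Fin.last n)
  let ν' : ProbabilityMeasure Ξ := E.map hm0.aemeasurable
  have hν' : (ν' : Measure Ξ) = (E : Measure 𝒰).map (fun U : 𝒰 => U.1 0) := rfl
  have htend : Tendsto ν atTop (𝓝 ν') := by
    rw [ProbabilityMeasure.tendsto_iff_forall_integral_tendsto]
    intro φ
    rw [hν', integral_map hm0.aemeasurable φ.continuous.measurable.aestronglyMeasurable]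
    have h1 : ∀ k, ∫ x, φ x ∂(ν k : Measure Ξ) = ∫ U : 𝒰, φ (U.1 0) ∂(F k : Measure 𝒰) := fun k => by
      rw [← hF1 k, initialLaw,
        integral_map hm0.aemeasurable φ.continuous.measurable.aestronglyMeasurable]
    simp only [h1]
    exact hlim _ (φ.continuous.measurable.comp hm0) ⟨‖φ‖, fun U => φ.norm_coe_le_norm _⟩
  refine ⟨ν', hN.mem_of_tendsto htend (Eventually.of_forall hνN), rfl, ?_⟩
  ext B hB
  have hpre := hml hB
  have h1 := hlim ((fun U : 𝒰 => U.1 (Fin.last n)) ⁻¹' B |>.indicator fun _ => 1)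
    (measurable_const.indicator hpre) ⟨1, fun U => by
      by_cases hU : U ∈ (fun U : 𝒰 => U.1 (Fin.last n)) ⁻¹' B <;> simp [Set.indicator, hU]⟩
  simp only [integral_indicator_const (1 : ℝ) hpre, smul_eq_mul, mul_one] at h1
  have h2 : ∀ G : ProbabilityMeasure 𝒰,
      terminalLaw G B = (G : Measure 𝒰) ((fun U : 𝒰 => U.1 (Fin.last n)) ⁻¹' B) := fun G => by
    rw [terminalLaw, Measure.map_apply hml hB]
  have h3 : ∀ k, (F k : Measure 𝒰).real ((fun U : 𝒰 => U.1 (Fin.last n)) ⁻¹' B) =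
      (terminalLaw F₀ B).toReal := fun k => by
    rw [← hF2 k, h2]; rfl
  simp only [h3] at h1
  have h4 := tendsto_nhds_unique h1 tendsto_const_nhds
  rw [h2, ← ENNReal.toReal_eq_toReal_iff' (measure_ne_top _ _) (by rw [h2]; exact measure_ne_top _ _)]
  exact h4

end PathDuality

/-! ### Duality for the path problem -/

/-- An affine function on the line that is bounded above is constant. This turns bounds over free
multipliers into equality constraints. -/
theorem eq_zero_of_forall_add_mul_le {A B a : ℝ} (h : ∀ r : ℝ, A + r * B ≤ a) : B = 0 := by
  by_contra hB
  have h1 := h ((a + 1 - A) / B)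
  rw [div_mul_cancel₀ _ hB] at h1
  linarith

theorem EReal.coe_ennreal_nnreal_mul {c : ℝ≥0} {k : ℝ≥0∞} (hk : k ≠ ∞) :
    (((c : ℝ≥0∞) * k : ℝ≥0∞) : EReal) = (((c : ℝ) * k.toReal : ℝ) : EReal) := by
  lift k to ℝ≥0 using hk
  rw [← ENNReal.coe_mul, ENNReal.coe_toReal, ← NNReal.coe_mul]
  rfl

theorem mainTheorem10
    {Ξ : Type*} [TopologicalSpace Ξ] [PolishSpace Ξ] [MeasurableSpace Ξ] [BorelSpace Ξ]
    {n dP : ℕ} (𝒰 : Set (Fin (n + 1) → Ξ)) (h𝒰 : IsCompact 𝒰)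
    (F₀ : ProbabilityMeasure 𝒰)
    (N : Set (ProbabilityMeasure Ξ)) (hN_closed : IsClosed N)
    (hN_convex : Convex ℝ≥0 ((fun ν : ProbabilityMeasure Ξ => (ν : Measure Ξ)) '' N))
    {Θ V 𝓛 : Type*} [AddCommGroup 𝓛] [Module ℝ 𝓛]
    (G : Set 𝓛) (hG_nonempty : G.Nonempty) (hG_convex : Convex ℝ G)
    (hG_symm : ∀ g ∈ G, -g ∈ G) (hG_cone : ∀ g ∈ G, ∀ η : ℝ, 0 ≤ η → η • g ∈ G)
    (s : 𝒰 → Θ → V → ℝ) (m : 𝒰 → Θ → V → Fin dP → ℝ) (ψ : 𝒰 → Θ → V → 𝓛 → ℝ)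
    (hψ_linear : ∀ U θ v, ∀ g ∈ G, ∀ h ∈ G, ∀ a b : ℝ,
      ψ U θ v (a • g + b • h) = a * ψ U θ v g + b * ψ U θ v h)
    (hs_lsc : ∀ θ v, LowerSemicontinuous fun U => s U θ v)
    (hm_lsc : ∀ θ v i, LowerSemicontinuous fun U => m U θ v i)
    (hψ_lsc : ∀ θ v, ∀ g ∈ G, LowerSemicontinuous fun U => ψ U θ v g)
    (h_bdd : ∀ θ v, ∀ g ∈ G, ∃ C : ℝ, ∀ U,
      |s U θ v| + ∑ i, |m U θ v i| + |ψ U θ v g| ≤ C)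
    (δ : ℝ≥0) (P : Fin dP → ℝ) :
    PathDuality.lowerBound F₀ N G s m ψ δ P =
      ⨅ (θ : Θ) (v : V), ⨆ (lam : Fin dP → ℝ) (lamKL : ℝ≥0) (g : 𝓛) (_ : g ∈ G),
        PathDuality.bridgeValue F₀ N s m ψ θ v g lam lamKL
          - (((lamKL : ℝ) * (δ : ℝ) : ℝ) : EReal)
          - ((∑ i, lam i * P i : ℝ) : EReal) := by
  obtain ⟨g₁, hg₁⟩ := hG_nonempty
  have h0G : (0 : 𝓛) ∈ G := by simpa using hG_cone g₁ hg₁ 0 le_rfl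
  -- Symmetry and the cone property make `G` stable under all real scalars, which is what forces
  -- `E[ψ] = 0` and not merely `≤ 0`.
  have hsmulG : ∀ g ∈ G, ∀ r : ℝ, r • g ∈ G := fun g hg r => by
    rcases le_total 0 r with hr | hr
    · exact hG_cone g hg r hr
    · have := hG_symm _ (hG_cone g hg (-r) (neg_nonneg.2 hr))
      rwa [neg_smul, neg_neg] at this
  have hψ_zero : ∀ U θ v, ψ U θ v 0 = 0 := fun U θ v => by
    simpa using hψ_linear U θ v 0 h0G 0 h0G 0 0
  have hψ_smul : ∀ U θ v, ∀ g ∈ G, ∀ r : ℝ, ψ U θ v (r • g) = r * ψ U θ v g :=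
    fun U θ v g hg r => by simpa using hψ_linear U θ v g hg 0 h0G r 0
  have hsb : ∀ θ v, ∃ C, ∀ U, |s U θ v| ≤ C := fun θ v => by
    obtain ⟨C, hC⟩ := h_bdd θ v 0 h0G
    refine ⟨C, fun U => le_trans ?_ (hC U)⟩
    have := Finset.sum_nonneg fun i (_ : i ∈ Finset.univ) => abs_nonneg (m U θ v i)
    have := abs_nonneg (ψ U θ v 0)
    linarith
  have hmb : ∀ θ v i, ∃ C, ∀ U, |m U θ v i| ≤ C := fun θ v i => by
    obtain ⟨C, hC⟩ := h_bdd θ v 0 h0G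
    refine ⟨C, fun U => le_trans ?_ (hC U)⟩
    have := Finset.single_le_sum (fun i _ => abs_nonneg (m U θ v i)) (Finset.mem_univ i)
    have := abs_nonneg (ψ U θ v 0)
    have := abs_nonneg (s U θ v)
    linarith
  have hψb : ∀ θ v, ∀ g ∈ G, ∃ C, ∀ U, |ψ U θ v g| ≤ C := fun θ v g hg => by
    obtain ⟨C, hC⟩ := h_bdd θ v g hg
    refine ⟨C, fun U => le_trans ?_ (hC U)⟩
    have := Finset.sum_nonneg fun i (_ : i ∈ Finset.univ) => abs_nonneg (m U θ v i)
    have := abs_nonneg (s U θ v)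
    linarith
  have hint : ∀ (F : ProbabilityMeasure 𝒰) (h : 𝒰 → ℝ), Measurable h → (∃ C, ∀ U, |h U| ≤ C) →
      Integrable h (F : Measure 𝒰) := fun F h hm ⟨C, hC⟩ =>
    Integrable.of_bound hm.aestronglyMeasurable C (ae_of_all _ hC)
  have hsI : ∀ (F : ProbabilityMeasure 𝒰) θ v, Integrable (fun U => s U θ v) (F : Measure 𝒰) :=
    fun F θ v => hint F _ (hs_lsc θ v).measurable (hsb θ v)
  have hmI : ∀ (F : ProbabilityMeasure 𝒰) θ v i,
      Integrable (fun U => m U θ v i) (F : Measure 𝒰) :=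
    fun F θ v i => hint F _ (hm_lsc θ v i).measurable (hmb θ v i)
  have hψI : ∀ (F : ProbabilityMeasure 𝒰) θ v, ∀ g ∈ G,
      Integrable (fun U => ψ U θ v g) (F : Measure 𝒰) :=
    fun F θ v g hg => hint F _ (hψ_lsc θ v g hg).measurable (hψb θ v g hg)
  have hcostI : ∀ (F : ProbabilityMeasure 𝒰) θ v, ∀ g ∈ G, ∀ lam,
      Integrable (PathDuality.cost s m ψ θ v g lam) (F : Measure 𝒰) := fun F θ v g hg lam =>
    ((hsI F θ v).add (integrable_finsetSum _ fun i _ => (hmI F θ v i).const_mul (lam i))).add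
      (hψI F θ v g hg)
  have hcostE : ∀ (F : ProbabilityMeasure 𝒰) θ v, ∀ g ∈ G, ∀ lam,
      ∫ U, PathDuality.cost s m ψ θ v g lam U ∂(F : Measure 𝒰) =
        ∫ U, s U θ v ∂(F : Measure 𝒰) + ∑ i, lam i * ∫ U, m U θ v i ∂(F : Measure 𝒰) +
          ∫ U, ψ U θ v g ∂(F : Measure 𝒰) := fun F θ v g hg lam => by
    have hsum : Integrable (fun U => ∑ i, lam i * m U θ v i) (F : Measure 𝒰) :=
      integrable_finsetSum _ fun i _ => (hmI F θ v i).const_mul _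
    simp only [PathDuality.cost]
    rw [integral_add (f := fun U => s U θ v + ∑ i, lam i * m U θ v i)
      ((hsI F θ v).add hsum) (hψI F θ v g hg), integral_add (hsI F θ v) hsum,
      integral_finsetSum _ fun i _ => (hmI F θ v i).const_mul _]
    simp only [integral_const_mul]
  unfold PathDuality.lowerBound
  refine iInf_congr fun θ => iInf_congr fun v => le_antisymm ?_ ?_
  · by_contra hcon
    rw [not_le] at hcon
    obtain ⟨a, ha1, ha2⟩ := EReal.lt_iff_exists_real_btwn.1 hcon
    obtain ⟨F, hFK, hFkl, hFa⟩ := exists_klDiv_le_of_lagrangian_lt (μ := (F₀ : Measure 𝒰))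
      (K := PathDuality.admissibleLaws F₀ N) (PathDuality.admissibleLaws_combo F₀ hN_convex)
      (PathDuality.mem_admissibleLaws_of_tendsto F₀ hN_closed)
      (Q := (Set.univ : Set (Fin dP → ℝ)) ×ˢ G) (convex_univ.prod hG_convex)
      ⟨(0, 0), trivial, h0G⟩
      (c := fun y U => PathDuality.cost s m ψ θ v y.2 y.1 U - ∑ i, y.1 i * P i)
      (by
        rintro ⟨lam, g⟩ ⟨-, hg⟩
        have h1 := (hs_lsc θ v).measurable
        have h2 := fun i => (hm_lsc θ v i).measurable
        have h3 := (hψ_lsc θ v g hg).measurable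
        exact ((h1.add (Finset.measurable_sum _ fun i _ => (h2 i).const_mul (lam i))).add
          h3).sub_const _)
      (by
        rintro ⟨lam, g⟩ ⟨-, hg⟩
        obtain ⟨C₁, h1⟩ := hsb θ v
        choose C₂ h2 using hmb θ v
        obtain ⟨C₃, h3⟩ := hψb θ v g hg
        refine ⟨C₁ + ∑ i, |lam i| * C₂ i + C₃ + |∑ i, lam i * P i|, fun U => ?_⟩
        refine (abs_sub _ _).trans (add_le_add_left ?_ _)
        refine (abs_add_le _ _).trans (add_le_add ((abs_add_le _ _).trans (add_le_add (h1 U) ?_))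
          (h3 U))
        refine (Finset.abs_sum_le_sum_abs _ _).trans (Finset.sum_le_sum fun i _ => ?_)
        rw [abs_mul]
        exact mul_le_mul_of_nonneg_left (h2 i U) (abs_nonneg _))
      (by
        rintro ⟨lam, g⟩ ⟨-, hg⟩ ⟨lam', g'⟩ ⟨-, hg'⟩ p q hp hq hpq U
        obtain rfl : q = 1 - p := by linarith
        simp only [PathDuality.cost, Prod.smul_mk, Prod.mk_add_mk, Pi.add_apply, Pi.smul_apply, smul_eq_mul,
          hψ_linear U θ v g hg g' hg', add_mul, Finset.sum_add_distrib, mul_assoc,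
          ← Finset.mul_sum]
        ring)
      (δ := δ) (a := a)
      (by
        rintro ⟨lam, g⟩ ⟨-, hg⟩ t ht
        have h1 := (le_iSup₂_of_le lam t.toNNReal (le_iSup₂_of_le g hg le_rfl)).trans_lt ha1
        rw [EReal.sub_lt_iff (Or.inl (EReal.coe_ne_bot _)) (Or.inl (EReal.coe_ne_top _)),
          EReal.sub_lt_iff (Or.inl (EReal.coe_ne_bot _)) (Or.inl (EReal.coe_ne_top _)),
          PathDuality.bridgeValue] at h1
        simp only [iInf_lt_iff] at h1
        obtain ⟨ν, hν, F, hF, hlt⟩ := h1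
        -- Here `t > 0` is essential: with infinite entropy the penalty would be `⊤`, whereas at `t
        -- = 0` the convention `0 * ∞ = 0` would hide it.
        have hfin : klDiv (F : Measure 𝒰) (F₀ : Measure 𝒰) ≠ ∞ := by
          intro htop
          rw [htop, ENNReal.mul_top (by simpa using ht), EReal.coe_ennreal_top,
            EReal.coe_add_top] at hlt
          exact not_top_lt hlt
        refine ⟨F, ⟨ν, hν, hF⟩, hfin, ?_⟩
        rw [EReal.coe_ennreal_nnreal_mul hfin] at hlt
        have hlt' : ∫ U, PathDuality.cost s m ψ θ v g lam U ∂(F : Measure 𝒰) +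
            (t.toNNReal : ℝ) * (klDiv (F : Measure 𝒰) (F₀ : Measure 𝒰)).toReal <
            a + ∑ i, lam i * P i + (t.toNNReal : ℝ) * δ := by exact_mod_cast hlt
        rw [Real.coe_toNNReal t ht.le] at hlt'
        rw [integral_sub (hcostI F θ v g hg lam) (integrable_const _)]
        simp only [integral_const, probReal_univ, one_smul]
        linarith)
    have hFa' : ∀ lam : Fin dP → ℝ, ∀ g ∈ G,
        ∫ U, s U θ v ∂(F : Measure 𝒰) +
          ∑ i, lam i * (∫ U, m U θ v i ∂(F : Measure 𝒰) - P i) +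
          ∫ U, ψ U θ v g ∂(F : Measure 𝒰) ≤ a := fun lam g hg => by
      have h1 := hFa (lam, g) ⟨trivial, hg⟩
      rw [integral_sub (hcostI F θ v g hg lam) (integrable_const _),
        hcostE F θ v g hg] at h1
      simp only [integral_const, probReal_univ, one_smul] at h1
      simp only [mul_sub, Finset.sum_sub_distrib]
      linarith
    have hm_eq : ∀ i, ∫ U, m U θ v i ∂(F : Measure 𝒰) = P i := fun i => by
      refine sub_eq_zero.1 (eq_zero_of_forall_add_mul_le
        (A := ∫ U, s U θ v ∂(F : Measure 𝒰)) (a := a) fun r => ?_)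
      -- Letting `λ` run along the `i`-th axis with `g = 0` isolates the `i`-th moment.
      have h1 := hFa' (Pi.single i r) 0 h0G
      simpa [hψ_zero, Pi.single_apply] using h1
    have hψ_eq : ∀ g ∈ G, ∫ U, ψ U θ v g ∂(F : Measure 𝒰) = 0 := fun g hg => by
      refine eq_zero_of_forall_add_mul_le
        (A := ∫ U, s U θ v ∂(F : Measure 𝒰)) (a := a) fun r => ?_
      have h1 := hFa' 0 (r • g) (hsmulG g hg r)
      simpa [hψ_smul _ θ v g hg r, integral_const_mul] using h1
    have hs_le : ∫ U, s U θ v ∂(F : Measure 𝒰) ≤ a := by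
      simpa [hψ_zero] using hFa' 0 0 h0G
    have hsup : (⨆ g ∈ G, ((∫ U, ψ U θ v g ∂(F : Measure 𝒰) : ℝ) : EReal)) = 0 := by
      refine le_antisymm (iSup₂_le fun g hg => by simp [hψ_eq g hg]) ?_
      -- The element `g = 0` keeps the supremum in `EReal` from dropping to `⊥`.
      exact le_iSup₂_of_le 0 h0G (by simp [hψ_zero])
    rw [ENNReal.ofReal_coe_nnreal] at hFkl
    refine absurd ha2 (not_lt.2 ?_)
    have hFmem : F ∈ PathDuality.perturbationSet F₀ N δ := ⟨hFK, hFkl⟩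
    refine iInf_le_of_le F (iInf_le_of_le hFmem (iInf_le_of_le hm_eq (iInf_le_of_le hsup ?_)))
    exact_mod_cast hs_le
  · refine le_iInf fun F => le_iInf fun hF => le_iInf fun hm_eq => le_iInf fun hsup => ?_
    refine iSup_le fun lam => iSup_le fun t => iSup₂_le fun g hg => ?_
    obtain ⟨⟨ν, hν, hFc⟩, hFkl⟩ := hF
    have hfin : klDiv (F : Measure 𝒰) (F₀ : Measure 𝒰) ≠ ∞ :=
      (hFkl.trans_lt ENNReal.coe_lt_top).ne
    have hbridge : PathDuality.bridgeValue F₀ N s m ψ θ v g lam t ≤ _ :=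
      (iInf₂_le ν hν).trans (iInf₂_le F hFc)
    rw [EReal.coe_ennreal_nnreal_mul hfin, hcostE F θ v g hg] at hbridge
    have hψ_le : ∫ U, ψ U θ v g ∂(F : Measure 𝒰) ≤ 0 := by
      have h1 := (le_iSup₂ (f := fun (g : 𝓛) (_ : g ∈ G) =>
        ((∫ U, ψ U θ v g ∂(F : Measure 𝒰) : ℝ) : EReal)) g hg).trans_eq hsup
      exact_mod_cast h1
    have hkl : (t : ℝ) * (klDiv (F : Measure 𝒰) (F₀ : Measure 𝒰)).toReal ≤ t * δ :=
      mul_le_mul_of_nonneg_left (ENNReal.toReal_le_coe_of_le_coe hFkl) t.coe_nonneg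
    rw [EReal.sub_le_iff_le_add (Or.inl (EReal.coe_ne_bot _)) (Or.inl (EReal.coe_ne_top _)),
      EReal.sub_le_iff_le_add (Or.inl (EReal.coe_ne_bot _)) (Or.inl (EReal.coe_ne_top _))]
    refine hbridge.trans ?_
    simp only [hm_eq]
    norm_cast
    push_cast
    linarith
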